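/- Let $G$ be a finite directed graph (loops and multiple edges allowed) with vertex set $\mathcal V$ and non-empty edge set $\mathcal E$, and assume that $G$ is strongly connected (there is a directed path from every vertex to every vertex). Write $s(e)$ and $r(e)$ for the initial and the final vertex of an edge $e$. Let $\mathcal E^-=\{e^-:e\in\mathcal E\}$ and $\mathcal E^+=\{e^+:e\in\mathcal E\}$ be two disjoint copies of $\mathcal E$. The graph inverse semigroup of $G$ is the semigroup with zero generated by $\mathcal E^-\cup\{P_v:v\in\mathcal V\}\cup\mathcal E^+$ with the relations $P_u^2=P_u$, $P_uP_w=0$ $(u\neq w)$, $P_{s(e)}e^-=e^-=e^-P_{r(e)}$, $P_{r(e)}e^+=e^+=e^+P_{s(e)}$, $e^-e^+=P_{s(e)}$, and $f^-g^+=0$ $(f\ne g)$. The Markov-Dyck shift $D_G$ is the set of all $x\in(\mathcal E^-\cup\mathcal E^+)^{\mathbb Z}$ such that every finite word that appears in $x$ has a non-zero product in this semigroup. For $v\in\mathcal V$ let $X_v\subset D_G$ be the subsystem obtained by excluding the words $e^-e^+$ with $r(e)\neq v$ and the words $f^+g^-$ with $s(f)\ne v$. The topological entropy of a subshift $X$ is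 $h(X)=\lim_{n\to\infty}\frac1n\log\operatorname{card}\mathcal L_n(X)$, where $\mathcal L_n(X)$ is the set of words of length $n$ that appear in points of $X$. Let $A_G$ be the adjacency matrix of $G$ ($A_G(u,w)$ is the number of edges from $u$ to $w$), let $\rho$ be the inverse of its Perron eigenvalue (its spectral radius), let $p(z)=\det(I-A_Gz)$, let $p_v(z)$ be the determinant of the matrix $I-A_Gz$ with the $v$-th row and the $v$-th column deleted, and let $q_v=p/p_v$. Theorem. Let $v\in\mathcal V$ be such that $q_v(\rho^2)<\frac34$. Then the limit that defines $h(X_v)$ exists, and $$h(X_v)>-\log\rho+\frac{p_v(\rho)}{2\rho^2\,p'(\rho)}\Bigl[q_v(\rho^2)-\frac34\Bigr].$$ -/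

import Mathlib

open Filter Topology

noncomputable section

/-! ### Subshifts -/

namespace Subshift

variable {α : Type*}

/-- The word `x_i x_{i+1} ⋯ x_{i+n-1}` of the bi-infinite sequence `x`. -/
def block (x : ℤ → α) (i : ℤ) (n : ℕ) : Fin n → α :=
  fun k => x (i + (k : ℕ))

/-- The set of admissible words of length `n` of a subshift `X`:
the words of length `n` that appear somewhere in a point of `X`. -/
def language (X : Set (ℤ → α)) (n : ℕ) : Set (Fin n → α) :=
  {w | ∃ x ∈ X, ∃ i : ℤ, block x i n = w}

/-- The sequence `(1/n) log card L_n(X)`, whose limit is the topological entropy. -/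
def entropySeq (X : Set (ℤ → α)) (n : ℕ) : ℝ :=
  Real.log ((language X n).ncard : ℝ) / (n : ℝ)

/-- The topological entropy `h(X) = lim (1/n) log card L_n(X)`. -/
def entropy (X : Set (ℤ → α)) : ℝ :=
  limUnder atTop (entropySeq X)

end Subshift

/-! ### Directed graphs and their graph inverse semigroups -/

/-- A directed graph (loops and multiple edges allowed) with vertex set `V` and edge set `E`;
`s e` is the initial vertex and `r e` is the final vertex of the edge `e`. -/
structure DiMultigraph (V E : Type*) where
  s : E → V
  r : E → V

namespace DiMultigraph

variable {V E : Type*}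

/-- From every vertex there is a directed path to every vertex. -/
def StronglyConnected (G : DiMultigraph V E) : Prop :=
  ∀ u w : V, Relation.ReflTransGen (fun a b => ∃ e : E, G.s e = a ∧ G.r e = b) u w

/-- The adjacency matrix: the entry at `(u, w)` is the number of edges from `u` to `w`. -/
def adjacency (G : DiMultigraph V E) : Matrix V V ℝ :=
  fun u w => (Nat.card {e : E // G.s e = u ∧ G.r e = w} : ℝ)

/-- The generators `e⁻`, `P_v`, `e⁺` of the graph inverse semigroup. -/
inductive Gen (V E : Type*) where
  | neg : E → Gen V E
  | idem : V → Gen V E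
  | pos : E → Gen V E

/-- A generator as an element of the free monoid with zero. -/
def gen (a : Gen V E) : WithZero (FreeMonoid (Gen V E)) :=
  ((FreeMonoid.of a : FreeMonoid (Gen V E)) : WithZero (FreeMonoid (Gen V E)))

/-- The defining relations of the graph inverse semigroup of `G`. The generator `e⁻` runs from
`s e` to `r e`, and `e⁺` runs from `r e` back to `s e`. -/
inductive Rel (G : DiMultigraph V E) :
    WithZero (FreeMonoid (Gen V E)) → WithZero (FreeMonoid (Gen V E)) → Prop
  | idem_sq (u : V) : Rel G (gen (.idem u) * gen (.idem u)) (gen (.idem u))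
  | idem_mul (u w : V) (h : u ≠ w) : Rel G (gen (.idem u) * gen (.idem w)) 0
  | idem_neg (e : E) : Rel G (gen (.idem (G.s e)) * gen (.neg e)) (gen (.neg e))
  | neg_idem (e : E) : Rel G (gen (.neg e) * gen (.idem (G.r e))) (gen (.neg e))
  | idem_pos (e : E) : Rel G (gen (.idem (G.r e)) * gen (.pos e)) (gen (.pos e))
  | pos_idem (e : E) : Rel G (gen (.pos e) * gen (.idem (G.s e))) (gen (.pos e))
  | neg_pos_self (e : E) : Rel G (gen (.neg e) * gen (.pos e)) (gen (.idem (G.s e)))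
  | neg_pos (f g : E) (h : f ≠ g) : Rel G (gen (.neg f) * gen (.pos g)) 0

/-- The congruence generated by the relations of the graph inverse semigroup. -/
def invCon (G : DiMultigraph V E) : Con (WithZero (FreeMonoid (Gen V E))) :=
  conGen G.Rel

/-- The graph inverse semigroup of `G` (with an identity adjoined, which serves as the product
of the empty word): the semigroup with zero generated by `e⁻`, `P_v`, `e⁺` subject to
the relations `Rel`. -/
def InvSemigroup (G : DiMultigraph V E) : Type _ := G.invCon.Quotient

instance (G : DiMultigraph V E) : Monoid G.InvSemigroup :=
  inferInstanceAs (Monoid G.invCon.Quotient)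

instance (G : DiMultigraph V E) : Zero G.InvSemigroup :=
  ⟨((0 : WithZero (FreeMonoid (Gen V E))) : G.invCon.Quotient)⟩

/-! ### Markov-Dyck shifts -/

/-- The element of the graph inverse semigroup that is given by a letter of the alphabet
`E⁻ ∪ E⁺`; here `Sum.inl e` is the letter `e⁻` and `Sum.inr e` is the letter `e⁺`. -/
def letter (G : DiMultigraph V E) : E ⊕ E → G.InvSemigroup
  | Sum.inl e => ((gen (.neg e) : WithZero (FreeMonoid (Gen V E))) : G.invCon.Quotient)
  | Sum.inr e => ((gen (.pos e) : WithZero (FreeMonoid (Gen V E))) : G.invCon.Quotient)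

/-- The product in the graph inverse semigroup of the letters of a word. -/
def wordProd (G : DiMultigraph V E) {n : ℕ} (w : Fin n → E ⊕ E) : G.InvSemigroup :=
  (List.ofFn fun k => G.letter (w k)).prod

/-- The Markov-Dyck shift `D_G`: all bi-infinite sequences over `E⁻ ∪ E⁺` in which every finite
word has a non-zero product in the graph inverse semigroup. -/
def markovDyck (G : DiMultigraph V E) : Set (ℤ → E ⊕ E) :=
  {x | ∀ (i : ℤ) (n : ℕ), G.wordProd (Subshift.block x i n) ≠ 0}

/-- The subsystem `X_v` of `D_G` that is obtained by excluding the words `e⁻e⁺` with `r e ≠ v`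
and the words `f⁺g⁻` with `s f ≠ v`. -/
def markovDyckAt (G : DiMultigraph V E) (v : V) : Set (ℤ → E ⊕ E) :=
  {x | x ∈ G.markovDyck ∧
    (∀ (i : ℤ) (e : E), G.r e ≠ v → ¬ (x i = Sum.inl e ∧ x (i + 1) = Sum.inr e)) ∧
    (∀ (i : ℤ) (f g : E), G.s f ≠ v → ¬ (x i = Sum.inr f ∧ x (i + 1) = Sum.inl g))}

/-! ### The quantities `ρ`, `p`, `p_v`, `q_v` -/

variable [Fintype V] [DecidableEq V]

/-- The Perron eigenvalue of the adjacency matrix, that is, its spectral radius. -/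
def perron (G : DiMultigraph V E) : ℝ :=
  (spectralRadius ℂ (G.adjacency.map (fun t : ℝ => (t : ℂ)))).toReal

/-- The inverse `ρ` of the Perron eigenvalue. -/
def rho (G : DiMultigraph V E) : ℝ := (G.perron)⁻¹

/-- `p(z) = det (I - A z)`. -/
def p (G : DiMultigraph V E) (z : ℝ) : ℝ :=
  (1 - z • G.adjacency).det

/-- `p_v(z)`: the determinant of `I - A z` with the `v`-th row and `v`-th column deleted. -/
def pAt (G : DiMultigraph V E) (v : V) (z : ℝ) : ℝ :=
  ((1 - z • G.adjacency).submatrix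
    (fun u : {u : V // u ≠ v} => (u : V)) (fun u : {u : V // u ≠ v} => (u : V))).det

/-- `q_v = p / p_v`. -/
def qAt (G : DiMultigraph V E) (v : V) (z : ℝ) : ℝ := G.p z / G.pAt v z

end DiMultigraph

end

/-! ### Perron–Frobenius theory for irreducible nonnegative matrices. -/

namespace Matrix

variable {V : Type*} [Fintype V]

/-! Let `F` be the generating function of the first-return loops at `v` (`returnSum`). Cramer's rule
gives `p = (1 - F) p_v` on `[0, ρ]` (`p_eq`), and a maximum principle gives `p_v ≠ 0` on `(0, ρ]`.
Thus `q_v = 1 - F` there, `F(ρ) = 1`, and `F` has left slope `d = -p'(ρ)/p_v(ρ)` at `ρ`. The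
hypothesis says `F(ρ²) > 1/4`.

Balanced words nested from first-return loops turn only at `v`, so they occur in `X_v`; nonvanishing
of products is certified by an action on stacks. Unique decoding gives their generating function `D`
the equation `D = 1 + F(z²) D²`, which has a finite solution only if `F(z²) ≤ 1/4`. Since `D` is
dominated by the generating function of the language, `h(X_v) < -log z` forces `F(z²) ≤ 1/4`.

Suppose `h(X_v) ≤ -log ρ + δ`. Then `F(z²) ≤ 1/4` for all positive `z < ρ e^{-δ}`. By convexity no
secant of `F` is steeper than `d`, and `ρ² ≤ ρ`, so in the limit `F(ρ²) - 1/4 ≤ dρ²(1 - e^{-2δ}) <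
2dρ²δ`. The `δ` of the theorem turns this into a contradiction. Existence of the limit is Fekete's
lemma. -/

theorem mulVec_mono {A : Matrix V V ℝ} (hA : ∀ i j, 0 ≤ A i j) {x y : V → ℝ}
    (h : ∀ i, x i ≤ y i) (i : V) : (A *ᵥ x) i ≤ (A *ᵥ y) i :=
  Finset.sum_le_sum fun j _ => mul_le_mul_of_nonneg_left (h j) (hA i j)

/-- The maximum principle: a subharmonic vector for `t * A` that vanishes somewhere is zero. -/
theorem eq_zero_of_le_mulVec {A : Matrix V V ℝ} (hA : ∀ i j, 0 ≤ A i j)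
    (hirr : ∀ i j, Relation.ReflTransGen (fun a b => 0 < A a b) i j)
    {w y : V → ℝ} {t : ℝ} (ht : 0 < t) (hw : ∀ i, 0 < w i) (hAw : ∀ i, t * (A *ᵥ w) i ≤ w i)
    {v : V} (hv : y v = 0) (hy : ∀ i, i ≠ v → |y i| ≤ t * (A *ᵥ fun j => |y j|) i) : y = 0 := by
  have : Nonempty V := ⟨v⟩
  obtain ⟨i₀, hi₀⟩ := Finite.exists_max fun i => |y i| / w i
  set m := |y i₀| / w i₀
  have hm : ∀ i, |y i| ≤ m * w i := fun i => (div_le_iff₀ (hw i)).1 (hi₀ i)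
  by_contra hne
  have hm0 : 0 < m := by
    obtain ⟨i, hi⟩ := Function.ne_iff.1 hne
    exact (div_pos (abs_pos.2 hi) (hw i)).trans_le (hi₀ i)
  -- Maximality of the ratio propagates along edges: a strict deficit at a successor `c` of `b`
  -- would force one at `b`. So it reaches `v`, where `y` vanishes.
  have hmax : ∀ i, |y i| = m * w i := by
    intro i
    induction hirr i₀ i with
    | refl => exact (div_mul_cancel₀ _ (hw i₀).ne').symm
    | @tail b c _ hbc ih =>
      by_contra hlt
      have hlt : |y c| < m * w c := lt_of_le_of_ne (hm c) hlt
      have hbv : b ≠ v := by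
        rintro rfl
        rw [hv, abs_zero] at ih
        exact (mul_pos hm0 (hw b)).ne ih
      have h1 : (A *ᵥ fun j => |y j|) b < (A *ᵥ fun j => m * w j) b :=
        Finset.sum_lt_sum (fun j _ => mul_le_mul_of_nonneg_left (hm j) (hA b j))
          ⟨c, Finset.mem_univ _, mul_lt_mul_of_pos_left hlt hbc⟩
      have h2 : (A *ᵥ fun j => m * w j) b = m * (A *ᵥ w) b := by
        have : (fun j => m * w j) = m • w := rfl
        rw [this, mulVec_smul]; rfl
      have h3 := hy b hbv
      have h4 := mul_le_mul_of_nonneg_left (hAw b) hm0.le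
      have h5 := mul_lt_mul_of_pos_left h1 ht
      rw [h2] at h5
      linarith
  have := hmax v
  rw [hv, abs_zero] at this
  exact (mul_pos hm0 (hw v)).ne this

variable [DecidableEq V]

theorem spectralRadius_complex_ne_top [Nonempty V] (B : Matrix V V ℂ) :
    spectralRadius ℂ B ≠ ⊤ := by
  let _ := Matrix.linftyOpNormedRing (n := V) (α := ℂ)
  let _ := Matrix.linftyOpNormedAlgebra (n := V) (R := ℂ) (α := ℂ)
  exact ((spectrum.spectralRadius_le_nnnorm (𝕜 := ℂ) B).trans_lt ENNReal.coe_lt_top).ne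

theorem pow_mul_le_pow_mulVec {A : Matrix V V ℝ} (hA : ∀ i j, 0 ≤ A i j) {y : V → ℝ} {t : ℝ}
    (ht : 0 ≤ t) (h : ∀ i, t * y i ≤ (A *ᵥ y) i) (n : ℕ) (i : V) :
    t ^ n * y i ≤ ((A ^ n) *ᵥ y) i := by
  induction n generalizing i with
  | zero => simp
  | succ n ih =>
    have h1 := mulVec_mono hA ih i
    have h2 : (A *ᵥ fun j => t ^ n * y j) i = t ^ n * (A *ᵥ y) i := by
      have : (fun j => t ^ n * y j) = t ^ n • y := rfl
      rw [this, mulVec_smul]; rfl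
    rw [pow_succ' A, ← mulVec_mulVec]
    calc t ^ (n + 1) * y i = t ^ n * (t * y i) := by ring
      _ ≤ t ^ n * (A *ᵥ y) i := mul_le_mul_of_nonneg_left (h i) (pow_nonneg ht n)
      _ ≤ _ := h2 ▸ h1

/-- A nonzero nonnegative vector that is expanded by the factor `t` bounds the spectral radius
from below. -/
theorem le_toReal_spectralRadius [Nonempty V] {A : Matrix V V ℝ} (hA : ∀ i j, 0 ≤ A i j)
    {y : V → ℝ} {t : ℝ} (ht : 0 ≤ t) (hy0 : ∀ i, 0 ≤ y i) (hy : y ≠ 0)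
    (h : ∀ i, t * y i ≤ (A *ᵥ y) i) :
    t ≤ (spectralRadius ℂ (A.map (fun t : ℝ => (t : ℂ)))).toReal := by
  let _ := Matrix.linftyOpNormedRing (n := V) (α := ℂ)
  let _ := Matrix.linftyOpNormedAlgebra (n := V) (R := ℂ) (α := ℂ)
  set B := A.map (fun t : ℝ => (t : ℂ)) with hB
  have hpow : ∀ n, t ^ n ≤ ‖B ^ n‖ := by
    intro n
    have hBn : B ^ n = (A ^ n).map (Complex.ofRealHom) := by
      rw [Matrix.map_pow]; rfl
    set yc : V → ℂ := fun i => (y i : ℂ) with hyc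
    have hmv : ∀ i, (B ^ n *ᵥ yc) i = (((A ^ n) *ᵥ y) i : ℝ) := by
      intro i
      rw [hBn]
      simp [mulVec, dotProduct, hyc]
    have hle : ‖(t ^ n) • y‖ ≤ ‖B ^ n *ᵥ yc‖ := by
      refine (pi_norm_le_iff_of_nonneg (norm_nonneg _)).2 fun i => ?_
      refine le_trans ?_ (norm_le_pi_norm _ i)
      rw [hmv, Complex.norm_real]
      have h0 : 0 ≤ t ^ n * y i := mul_nonneg (pow_nonneg ht n) (hy0 i)
      have := pow_mul_le_pow_mulVec hA ht h n i
      simp only [Pi.smul_apply, smul_eq_mul, Real.norm_eq_abs]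
      rw [abs_of_nonneg h0, abs_of_nonneg (h0.trans this)]
      exact this
    have hyn : ‖yc‖ = ‖y‖ := by
      simp [hyc, Pi.norm_def, Complex.nnnorm_real]
    have h3 := hle.trans (Matrix.linfty_opNorm_mulVec (B ^ n) yc)
    rw [norm_smul, hyn, Real.norm_of_nonneg (pow_nonneg ht n)] at h3
    exact le_of_mul_le_mul_right h3 (norm_pos_iff.2 hy)
  -- Gelfand's formula turns the bounds `t ^ n ≤ ‖B ^ n‖` into a bound on the spectral radius.
  have hlim := spectrum.pow_norm_pow_one_div_tendsto_nhds_spectralRadius B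
  have : ENNReal.ofReal t ≤ spectralRadius ℂ B := by
    refine ge_of_tendsto hlim ?_
    filter_upwards [eventually_ge_atTop 1] with n hn
    refine ENNReal.ofReal_le_ofReal ?_
    have hn' : (n : ℝ) ≠ 0 := by positivity
    calc t = (t ^ n) ^ (1 / n : ℝ) := by
          rw [one_div, Real.pow_rpow_inv_natCast ht (by omega)]
      _ ≤ _ := Real.rpow_le_rpow (pow_nonneg ht n) (hpow n) (by positivity)
  exact (ENNReal.ofReal_le_iff_le_toReal (spectralRadius_complex_ne_top B)).1 this

/-- The moduli of an eigenvector for a dominant eigenvalue form a vector that is expanded by the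
spectral radius. -/
theorem exists_nonneg_spectralRadius_le [Nonempty V] {A : Matrix V V ℝ}
    (hA : ∀ i j, 0 ≤ A i j) :
    ∃ y : V → ℝ, (∀ i, 0 ≤ y i) ∧ y ≠ 0 ∧
      ∀ i, (spectralRadius ℂ (A.map (fun t : ℝ => (t : ℂ)))).toReal * y i ≤ (A *ᵥ y) i := by
  let _ := Matrix.linftyOpNormedRing (n := V) (α := ℂ)
  let _ := Matrix.linftyOpNormedAlgebra (n := V) (R := ℂ) (α := ℂ)
  set B := A.map (fun t : ℝ => (t : ℂ)) with hB
  obtain ⟨k, hk, hkr⟩ := spectrum.exists_nnnorm_eq_spectralRadius B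
  rw [← Matrix.spectrum_toLin', ← Module.End.hasEigenvalue_iff_mem_spectrum] at hk
  obtain ⟨x, hx⟩ := hk.exists_hasEigenvector
  refine ⟨fun i => ‖x i‖, fun i => norm_nonneg _, ?_, fun i => ?_⟩
  · intro h
    exact hx.2 (funext fun i => norm_eq_zero.1 (congrFun h i))
  · have h1 : B *ᵥ x = k • x := by simpa using hx.apply_eq_smul
    have h2 : (spectralRadius ℂ B).toReal = ‖k‖ := by rw [← hkr]; simp
    rw [h2, ← norm_mul]
    have h3 : k * x i = (B *ᵥ x) i := by rw [h1]; rfl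
    rw [h3]
    refine (norm_sum_le _ _).trans (le_of_eq ?_)
    refine Finset.sum_congr rfl fun j _ => ?_
    simp [hB, abs_of_nonneg (hA i j)]

/-- For an irreducible matrix, powers of `1 + A` spread the support of a nonnegative vector. -/
theorem exists_one_add_pow_mulVec_pos {A : Matrix V V ℝ} (hA : ∀ i j, 0 ≤ A i j)
    (hirr : ∀ i j, Relation.ReflTransGen (fun a b => 0 < A a b) i j)
    {d : V → ℝ} (hd : ∀ i, 0 ≤ d i) (hd0 : d ≠ 0) :
    ∃ N : ℕ, ∀ i, 0 < (((1 + A) ^ N) *ᵥ d) i := by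
  have hstep : ∀ n i, (((1 + A) ^ (n + 1)) *ᵥ d) i =
      (((1 + A) ^ n) *ᵥ d) i + (A *ᵥ (((1 + A) ^ n) *ᵥ d)) i := by
    intro n i
    rw [pow_succ', ← mulVec_mulVec, add_mulVec, one_mulVec]; rfl
  have hnn : ∀ n i, 0 ≤ (((1 + A) ^ n) *ᵥ d) i := by
    intro n
    induction n with
    | zero => simpa using hd
    | succ n ih =>
      intro i
      rw [hstep]
      exact add_nonneg (ih i) (Finset.sum_nonneg fun j _ => mul_nonneg (hA i j) (ih j))
  -- The summand `1` keeps positive entries positive, so one exponent serves all vertices and no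
  -- aperiodicity is needed.
  have hmono : ∀ i, Monotone fun n => (((1 + A) ^ n) *ᵥ d) i := by
    intro i
    refine monotone_nat_of_le_succ fun n => ?_
    rw [hstep]
    exact le_add_of_nonneg_right (Finset.sum_nonneg fun j _ => mul_nonneg (hA i j) (hnn n j))
  obtain ⟨j, hj⟩ := Function.ne_iff.1 hd0
  have hex : ∀ i, ∃ n, 0 < (((1 + A) ^ n) *ᵥ d) i := by
    intro i
    induction hirr i j using Relation.ReflTransGen.head_induction_on with
    | refl => exact ⟨0, by simpa using lt_of_le_of_ne (hd j) (Ne.symm hj)⟩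
    | head hab _ ih =>
      obtain ⟨n, hn⟩ := ih
      refine ⟨n + 1, ?_⟩
      rw [hstep]
      refine add_pos_of_nonneg_of_pos (hnn n _) ?_
      exact Finset.sum_pos' (fun k _ => mul_nonneg (hA _ k) (hnn n k))
        ⟨_, Finset.mem_univ _, mul_pos hab hn⟩
  choose n hn using hex
  refine ⟨Finset.univ.sup n, fun i => (hn i).trans_le (hmono i (Finset.le_sup (Finset.mem_univ i)))⟩

/-- **Perron's theorem**: an irreducible nonnegative matrix has a positive eigenvector for its
spectral radius. -/
theorem exists_pos_mulVec_eq_spectralRadius [Nonempty V] {A : Matrix V V ℝ}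
    (hA : ∀ i j, 0 ≤ A i j)
    (hirr : ∀ i j, Relation.ReflTransGen (fun a b => 0 < A a b) i j) :
    ∃ w : V → ℝ, (∀ i, 0 < w i) ∧
      A *ᵥ w = (spectralRadius ℂ (A.map (fun t : ℝ => (t : ℂ)))).toReal • w := by
  obtain ⟨y, hy0, hy, hle⟩ := exists_nonneg_spectralRadius_le hA
  set l := (spectralRadius ℂ (A.map (fun t : ℝ => (t : ℂ)))).toReal with hl
  have hl0 : 0 ≤ l := ENNReal.toReal_nonneg
  have hcomm : ∀ N, Commute A ((1 + A) ^ N) := fun N =>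
    ((Commute.one_right A).add_right (Commute.refl A)).pow_right N
  have heig : A *ᵥ y = l • y := by
    -- Otherwise `(1 + A) ^ N`, which commutes with `A`, makes the nonzero defect positive
    -- everywhere. The vector `P *ᵥ y` is then expanded by `l + ε`, more than the spectral radius
    -- allows.
    by_contra hne
    have hd0 : A *ᵥ y - l • y ≠ 0 := sub_ne_zero.2 hne
    obtain ⟨N, hN⟩ := exists_one_add_pow_mulVec_pos hA hirr (d := A *ᵥ y - l • y)
      (fun i => by simpa using hle i) hd0
    obtain ⟨M, hM⟩ := exists_one_add_pow_mulVec_pos hA hirr hy0 hy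
    set P := (1 + A) ^ N
    set u := (1 + A) ^ M *ᵥ y
    have hP0 : ∀ i j, 0 ≤ P i j := by
      have : ∀ n i j, 0 ≤ ((1 + A) ^ n : Matrix V V ℝ) i j := by
        intro n
        induction n with
        | zero => intro i j; simp [Matrix.one_apply]; split_ifs <;> simp
        | succ n ih =>
          intro i j
          rw [pow_succ, Matrix.mul_apply]
          refine Finset.sum_nonneg fun k _ => mul_nonneg (ih i k) ?_
          rw [Matrix.add_apply, Matrix.one_apply]
          have := hA k j
          split_ifs <;> linarith
      exact this N
    have hx0 : ∀ i, 0 ≤ (P *ᵥ y) i := fun i =>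
      Finset.sum_nonneg fun j _ => mul_nonneg (hP0 i j) (hy0 j)
    have hgap : ∀ i, 0 < (A *ᵥ (P *ᵥ y)) i - l * (P *ᵥ y) i := by
      intro i
      have := hN i
      rw [mulVec_sub, mulVec_smul, mulVec_mulVec, ← (hcomm N).eq, ← mulVec_mulVec] at this
      simpa using this
    have hε : ∃ ε > 0, ∀ i, ε * (P *ᵥ y) i ≤ (A *ᵥ (P *ᵥ y)) i - l * (P *ᵥ y) i := by
      obtain ⟨i₀, hi₀⟩ := Finite.exists_min fun i => (A *ᵥ (P *ᵥ y)) i - l * (P *ᵥ y) i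
      obtain ⟨i₁, hi₁⟩ := Finite.exists_max fun i => (P *ᵥ y) i
      have h1 : 0 < (P *ᵥ y) i₁ + 1 := by linarith [hx0 i₁]
      refine ⟨_ / ((P *ᵥ y) i₁ + 1), div_pos (hgap i₀) h1, fun i => ?_⟩
      rw [div_mul_eq_mul_div, div_le_iff₀ h1]
      have := hi₁ i
      have := hi₀ i
      exact mul_le_mul (hi₀ i) (by linarith [hi₁ i]) (hx0 i) (hgap i).le
    obtain ⟨ε, hε0, hε⟩ := hε
    have hPy : P *ᵥ y ≠ 0 := by
      intro h0
      have h := hgap (Classical.arbitrary V)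
      rw [h0] at h
      simp at h
    have := le_toReal_spectralRadius hA (t := l + ε) (by linarith) hx0 hPy
      (fun i => by linarith [hε i])
    linarith
  -- `y` is so far only known to be nonnegative; applying `(1 + A) ^ N` keeps it an eigenvector and
  -- makes it positive.
  obtain ⟨N, hN⟩ := exists_one_add_pow_mulVec_pos hA hirr hy0 hy
  refine ⟨_, hN, ?_⟩
  rw [mulVec_mulVec, (hcomm N).eq, ← mulVec_mulVec, heig, mulVec_smul]

end Matrix

/-! ### Generating functions of first-passage paths. -/

namespace DiMultigraph

open scoped ENNReal

variable {V E : Type*}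

/-- The edge list `l` is a path from `u` to `v` of positive length that visits `v` only at its end
(and possibly at its start). -/
def FirstPassage (G : DiMultigraph V E) (v : V) : V → List E → Prop
  | _, [] => False
  | u, e :: l => G.s e = u ∧ ((G.r e = v ∧ l = []) ∨ (G.r e ≠ v ∧ FirstPassage G v (G.r e) l))

open Classical in
/-- The generating function of the first-passage paths from `u` to `v` of length at most `n`. -/
noncomputable def passageSum (G : DiMultigraph V E) (v : V) (z : ℝ≥0∞) (n : ℕ∞) (u : V) : ℝ≥0∞ :=
  ∑' l : List E, if G.FirstPassage v u l ∧ (l.length : ℕ∞) ≤ n then z ^ l.length else 0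

theorem tsum_list_eq {α : Type*} (f : List α → ℝ≥0∞) :
    ∑' l, f l = f [] + ∑' a, ∑' l, f (a :: l) := by
  classical
  rw [ENNReal.tsum_eq_add_tsum_ite [], ← ENNReal.tsum_prod (f := fun a l => f (a :: l))]
  congr 1
  have hinj : Function.Injective fun q : α × List α => q.1 :: q.2 := by
    rintro ⟨a, l⟩ ⟨b, m⟩ h
    simpa using h
  rw [← hinj.tsum_eq]
  · simp
  · rintro (_ | ⟨a, l⟩) h
    · simp at h
    · exact ⟨(a, l), rfl⟩

open Classical in
-- Split off the first edge. As `⊤ + 1 = ⊤`, the case `n = ⊤` is a fixed-point equation, while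
-- finite `n` allows induction.
theorem passageSum_succ (G : DiMultigraph V E) (v : V) (z : ℝ≥0∞) (n : ℕ∞) (u : V) :
    G.passageSum v z (n + 1) u = ∑' e, if G.s e = u then
      z * (if G.r e = v then 1 else G.passageSum v z n (G.r e)) else 0 := by
  rw [passageSum, tsum_list_eq]
  simp only [FirstPassage, false_and, if_false, zero_add]
  refine tsum_congr fun e => ?_
  by_cases hs : G.s e = u
  · by_cases hr : G.r e = v
    · rw [tsum_eq_single []]
      · simp [hs, hr]
      · intro l hl
        simp [hs, hr, hl]
    · simp only [hs, hr, true_and, false_and, false_or, not_false_eq_true, ne_eq, if_true, if_false,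
        passageSum, ← ENNReal.tsum_mul_left]
      refine tsum_congr fun l => ?_
      have : ((l.length : ℕ∞) + 1 ≤ n + 1) ↔ (l.length : ℕ∞) ≤ n :=
        ENat.add_le_add_iff_right (by simp)
      simp only [List.length_cons, Nat.cast_succ, this, mul_ite, mul_zero, pow_succ']
  · simp [hs]

theorem passageSum_zero (G : DiMultigraph V E) (v : V) (z : ℝ≥0∞) (u : V) :
    G.passageSum v z 0 u = 0 := by
  refine ENNReal.tsum_eq_zero.2 fun l => if_neg ?_
  rintro ⟨h, hl⟩
  cases l with
  | nil => exact h
  | cons => simp at hl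

/-- A finite partial sum involves only paths of bounded length. -/
theorem passageSum_top_le (G : DiMultigraph V E) {v : V} {z : ℝ≥0∞} {u : V} {b : ℝ≥0∞}
    (h : ∀ n : ℕ, G.passageSum v z n u ≤ b) : G.passageSum v z ⊤ u ≤ b := by
  rw [passageSum, ENNReal.tsum_eq_iSup_sum]
  refine iSup_le fun t => le_trans ?_ ((ENNReal.sum_le_tsum t).trans (h (t.sup List.length)))
  refine Finset.sum_le_sum fun l hl => ?_
  have : (l.length : ℕ∞) ≤ ((t.sup List.length : ℕ) : ℕ∞) := by
    exact_mod_cast Finset.le_sup (f := List.length) hl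
  split_ifs with h1 h2
  exacts [le_rfl, absurd ⟨h1.1, this⟩ h2, zero_le, le_rfl]

theorem passageSum_mono (G : DiMultigraph V E) (v : V) {z z' : ℝ≥0∞} (h : z ≤ z') (n : ℕ∞) (u : V) :
    G.passageSum v z n u ≤ G.passageSum v z' n u := by
  refine ENNReal.tsum_le_tsum fun l => ?_
  split_ifs
  · gcongr
  · exact le_rfl

/-- The generating function of the first-return loops at `v`. -/
noncomputable def returnSum (G : DiMultigraph V E) (v : V) (z : ℝ) : ℝ :=
  (G.passageSum v (ENNReal.ofReal z) ⊤ v).toReal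

theorem returnSum_zero (G : DiMultigraph V E) (v : V) : G.returnSum v 0 = 0 := by
  have : G.passageSum v (ENNReal.ofReal 0) ⊤ v = 0 := by
    refine ENNReal.tsum_eq_zero.2 fun l => ?_
    cases l with
    | nil => simp [FirstPassage]
    | cons => simp
  rw [returnSum, this, ENNReal.toReal_zero]

theorem adjacency_nonneg (G : DiMultigraph V E) (u w : V) : 0 ≤ G.adjacency u w :=
  Nat.cast_nonneg _

theorem adjacency_pos_iff [Finite E] (G : DiMultigraph V E) (u w : V) :
    0 < G.adjacency u w ↔ ∃ e, G.s e = u ∧ G.r e = w := by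
  rw [adjacency, Nat.cast_pos, Nat.card_pos_iff]
  exact ⟨fun h => let ⟨e, he⟩ := h.1.some; ⟨e, he⟩, fun ⟨e, he⟩ => ⟨⟨e, he⟩, inferInstance⟩⟩

theorem StronglyConnected.reflTransGen_adjacency [Finite E] {G : DiMultigraph V E}
    (hG : G.StronglyConnected) (u w : V) :
    Relation.ReflTransGen (fun a b => 0 < G.adjacency a b) u w :=
  Relation.ReflTransGen.mono (fun a b h => (G.adjacency_pos_iff a b).2 h) u w (hG u w)

theorem StronglyConnected.exists_edge [Nonempty E] {G : DiMultigraph V E}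
    (hG : G.StronglyConnected) (u : V) : ∃ e, G.s e = u := by
  obtain ⟨e⟩ := ‹Nonempty E›
  rcases (hG u (G.s e)).cases_head with h | ⟨_, ⟨f, hf, _⟩, _⟩
  · exact ⟨e, h.symm⟩
  · exact ⟨f, hf⟩

theorem differentiable_det {n : Type*} [Fintype n] [DecidableEq n] {M : ℝ → Matrix n n ℝ}
    (hM : ∀ i j, Differentiable ℝ fun z => M z i j) : Differentiable ℝ fun z => (M z).det := by
  simp only [Matrix.det_apply]
  refine Differentiable.fun_sum fun σ _ => Differentiable.const_smul ?_ _
  exact Differentiable.fun_finsetProd fun i _ => hM _ _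

/-! ### The determinants `p` and `p_v` and their relation to the first-return loops. -/

section Adjacency

variable [Fintype V] [DecidableEq V]

theorem adjacency_mulVec [Fintype E] (G : DiMultigraph V E) (x : V → ℝ) (u : V) :
    (G.adjacency.mulVec x) u = ∑ e, if G.s e = u then x (G.r e) else 0 := by
  classical
  have h : ∀ w, G.adjacency u w * x w =
      ∑ e, if G.r e = w then (if G.s e = u then x w else 0) else 0 := by
    intro w
    rw [adjacency, Nat.card_eq_fintype_card, Fintype.card_subtype, Finset.card_eq_sum_ones,
      Finset.sum_filter, Nat.cast_sum, Finset.sum_mul]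
    refine Finset.sum_congr rfl fun e _ => ?_
    by_cases h1 : G.s e = u <;> by_cases h2 : G.r e = w <;> simp [h1, h2]
  simp only [Matrix.mulVec, dotProduct, h]
  rw [Finset.sum_comm]
  exact Finset.sum_congr rfl fun e _ => by simp

/-- A Perron vector of a strongly connected graph. -/
theorem StronglyConnected.exists_perron_vector [Finite E] [Nonempty V] {G : DiMultigraph V E}
    (hG : G.StronglyConnected) :
    ∃ w : V → ℝ, (∀ u, 0 < w u) ∧ G.adjacency.mulVec w = G.perron • w :=
  Matrix.exists_pos_mulVec_eq_spectralRadius G.adjacency_nonneg hG.reflTransGen_adjacency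

/-- Replacing row `v` by a unit vector leaves a block triangular matrix whose block at `v` is `1`.
-/
theorem adjugate_apply_self_eq_pAt (G : DiMultigraph V E) (v : V) (z : ℝ) :
    (1 - z • G.adjacency).adjugate v v = G.pAt v z := by
  rw [Matrix.adjugate_apply, Matrix.twoBlockTriangular_det _ (fun u => u ≠ v)]
  · have h1 : ∀ i : {u // ¬ u ≠ v}, (i : V) = v := fun i => not_not.1 i.2
    have : Unique {u // ¬ u ≠ v} := ⟨⟨⟨v, by simp⟩⟩, fun i => Subtype.ext (h1 i)⟩
    rw [Matrix.det_unique (n := {u // ¬ u ≠ v})]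
    have h2 : (Matrix.toSquareBlockProp ((1 - z • G.adjacency).updateRow v (Pi.single v 1))
        fun u => ¬ u ≠ v) default default = 1 := by
      simp [Matrix.toSquareBlockProp, h1]
    rw [h2, mul_one, pAt]
    congr 1
    ext i j
    simp [Matrix.toSquareBlockProp, Matrix.updateRow_ne i.2]
  · intro i hi j hj
    obtain rfl : i = v := not_not.1 hi
    simp [hj]

theorem differentiable_p (G : DiMultigraph V E) : Differentiable ℝ G.p :=
  differentiable_det fun i j => by
    simp only [Matrix.sub_apply, Matrix.smul_apply, smul_eq_mul]
    fun_prop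

theorem differentiable_pAt (G : DiMultigraph V E) (v : V) : Differentiable ℝ (G.pAt v) :=
  differentiable_det fun i j => by
    simp only [Matrix.submatrix_apply, Matrix.sub_apply, Matrix.smul_apply, smul_eq_mul]
    fun_prop

variable [Finite E] [Nonempty E] {G : DiMultigraph V E}

/-- At a vertex where the Perron vector is minimal, a single outgoing edge already contributes at
least the minimum. -/
theorem StronglyConnected.one_le_perron (hG : G.StronglyConnected) : 1 ≤ G.perron := by
  have := Fintype.ofFinite E
  have : Nonempty V := ⟨G.s (Classical.arbitrary E)⟩
  obtain ⟨w, hw, hAw⟩ := hG.exists_perron_vector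
  obtain ⟨u, hu⟩ := Finite.exists_min w
  have h := congrFun hAw u
  rw [adjacency_mulVec, Pi.smul_apply, smul_eq_mul] at h
  obtain ⟨e, he⟩ := hG.exists_edge u
  have h1 : w u ≤ ∑ e, if G.s e = u then w (G.r e) else 0 := by
    refine (hu (G.r e)).trans ?_
    have := Finset.single_le_sum (f := fun e => if G.s e = u then w (G.r e) else 0)
      (fun f _ => by split_ifs; exacts [(hw _).le, le_rfl]) (Finset.mem_univ e)
    simpa [he] using this
  rw [h] at h1
  exact le_of_mul_le_mul_right (by simpa using h1) (hw u)

theorem StronglyConnected.rho_pos (hG : G.StronglyConnected) : 0 < G.rho :=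
  inv_pos.2 (zero_lt_one.trans_le hG.one_le_perron)

theorem StronglyConnected.rho_le_one (hG : G.StronglyConnected) : G.rho ≤ 1 :=
  inv_le_one_of_one_le₀ hG.one_le_perron

theorem StronglyConnected.exists_rho_vector (hG : G.StronglyConnected) :
    ∃ w : V → ℝ, (∀ u, 0 < w u) ∧ ∀ u, G.rho * G.adjacency.mulVec w u = w u := by
  have : Nonempty V := ⟨G.s (Classical.arbitrary E)⟩
  obtain ⟨w, hw, hAw⟩ := hG.exists_perron_vector
  refine ⟨w, hw, fun u => ?_⟩
  rw [hAw, Pi.smul_apply, smul_eq_mul, ← mul_assoc, rho,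
    inv_mul_cancel₀ (zero_lt_one.trans_le hG.one_le_perron).ne', one_mul]

/-- The normalized Perron vector `w / w v` is a supersolution of the first-edge recursion at `ρ`, so
it bounds all truncated sums by induction. -/
theorem StronglyConnected.passageSum_ne_top (hG : G.StronglyConnected) (v u : V) {z : ℝ}
    (hz : z ≤ G.rho) : G.passageSum v (ENNReal.ofReal z) ⊤ u ≠ ⊤ := by
  have := Fintype.ofFinite E
  obtain ⟨w, hw, hAw⟩ := hG.exists_rho_vector
  have hbound : ∀ (n : ℕ) u, G.passageSum v (ENNReal.ofReal G.rho) n u ≤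
      ENNReal.ofReal (w u / w v) := by
    intro n
    induction n with
    | zero => intro u; simp [passageSum_zero]
    | succ n ih =>
      intro u
      rw [Nat.cast_succ, passageSum_succ, tsum_fintype, ← hAw u, adjacency_mulVec, mul_div_assoc,
        Finset.sum_div, Finset.mul_sum, ENNReal.ofReal_sum_of_nonneg]
      · refine Finset.sum_le_sum fun e _ => ?_
        split_ifs with h1 h2
        · rw [h2, div_self (hw v).ne', mul_one, mul_one]
        · rw [ENNReal.ofReal_mul hG.rho_pos.le]
          gcongr
          exact ih _
        · simp
      · intro e _
        have := hG.rho_pos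
        have := hw (G.r e)
        have := hw v
        split_ifs
        · positivity
        · simp
  refine ((G.passageSum_mono v (ENNReal.ofReal_le_ofReal hz) ⊤ u).trans
    (G.passageSum_top_le fun n => hbound n u)).trans_lt ENNReal.ofReal_lt_top |>.ne

/-- Termwise: a power series with nonnegative coefficients. -/
theorem StronglyConnected.convexOn_returnSum (hG : G.StronglyConnected) (v : V) :
    ConvexOn ℝ (Set.Icc 0 G.rho) (G.returnSum v) := by
  refine ⟨convex_Icc _ _, fun x hx y hy a b ha hb hab => ?_⟩
  have hfx := hG.passageSum_ne_top v v hx.2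
  have hfy := hG.passageSum_ne_top v v hy.2
  have key : G.passageSum v (ENNReal.ofReal (a • x + b • y)) ⊤ v ≤
      ENNReal.ofReal a * G.passageSum v (ENNReal.ofReal x) ⊤ v +
        ENNReal.ofReal b * G.passageSum v (ENNReal.ofReal y) ⊤ v := by
    simp only [passageSum]
    rw [← ENNReal.tsum_mul_left, ← ENNReal.tsum_mul_left, ← ENNReal.tsum_add]
    refine ENNReal.tsum_le_tsum fun l => ?_
    split_ifs
    · have h := (convexOn_pow l.length).2 (Set.mem_Ici.2 hx.1) (Set.mem_Ici.2 hy.1) ha hb hab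
      rw [smul_eq_mul, smul_eq_mul] at h ⊢
      have hx0 := hx.1
      have hy0 := hy.1
      rw [← ENNReal.ofReal_pow hx0, ← ENNReal.ofReal_pow hy0, ← ENNReal.ofReal_pow (by positivity),
        ← ENNReal.ofReal_mul ha, ← ENNReal.ofReal_mul hb,
        ← ENNReal.ofReal_add (by positivity) (by positivity)]
      exact ENNReal.ofReal_le_ofReal h
    · simp
  have h := ENNReal.toReal_mono (ENNReal.add_ne_top.2
    ⟨ENNReal.mul_ne_top ENNReal.ofReal_ne_top hfx, ENNReal.mul_ne_top ENNReal.ofReal_ne_top hfy⟩) key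
  rw [ENNReal.toReal_add (ENNReal.mul_ne_top ENNReal.ofReal_ne_top hfx)
    (ENNReal.mul_ne_top ENNReal.ofReal_ne_top hfy), ENNReal.toReal_mul, ENNReal.toReal_mul,
    ENNReal.toReal_ofReal ha, ENNReal.toReal_ofReal hb] at h
  exact h

/-- The vector of passage sums, reset to `1` at `v`, is mapped by `I - zA` to `1 - F(z)` times the
unit vector at `v`. Multiplying by the adjugate and reading off the entry at `v` gives the identity.
-/
theorem StronglyConnected.p_eq (hG : G.StronglyConnected) (v : V) {z : ℝ} (hz0 : 0 ≤ z)
    (hz : z ≤ G.rho) : G.p z = (1 - G.returnSum v z) * G.pAt v z := by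
  have := Fintype.ofFinite E
  set y : V → ℝ := fun u => if u = v then 1 else (G.passageSum v (ENNReal.ofReal z) ⊤ u).toReal
    with hy
  have hrec : ∀ u, (G.passageSum v (ENNReal.ofReal z) ⊤ u).toReal =
      z * (G.adjacency.mulVec y) u := by
    intro u
    have h : G.passageSum v (ENNReal.ofReal z) ⊤ u = _ := G.passageSum_succ v (ENNReal.ofReal z) ⊤ u
    rw [h, tsum_fintype, ENNReal.toReal_sum, adjacency_mulVec, Finset.mul_sum]
    · refine Finset.sum_congr rfl fun e _ => ?_
      by_cases h1 : G.s e = u <;> by_cases h2 : G.r e = v <;> simp [h1, h2, hy, hz0]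
    · intro e _
      split_ifs
      · simp
      · exact ENNReal.mul_ne_top ENNReal.ofReal_ne_top (hG.passageSum_ne_top v _ hz)
      · simp
  have hM : (1 - z • G.adjacency).mulVec y = Pi.single v (1 - G.returnSum v z) := by
    ext u
    rw [Matrix.sub_mulVec, Matrix.one_mulVec, Matrix.smul_mulVec, Pi.sub_apply, Pi.smul_apply,
      smul_eq_mul, ← hrec u]
    by_cases hu : u = v
    · subst hu
      simp [hy, returnSum]
    · simp [hy, hu]
  have h := congrArg ((1 - z • G.adjacency).adjugate.mulVec) hM
  rw [Matrix.mulVec_mulVec, Matrix.adjugate_mul, Matrix.smul_mulVec, Matrix.one_mulVec] at h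
  have h := congrFun h v
  rw [Matrix.mulVec_single] at h
  simp only [Pi.smul_apply, smul_eq_mul, hy, if_true, mul_one, MulOpposite.smul_eq_mul_unop,
    MulOpposite.unop_op, Matrix.col_apply] at h
  rw [adjugate_apply_self_eq_pAt] at h
  rw [p, h, mul_comm]

/-- A kernel vector of the reduced matrix, extended by `0` at `v`, satisfies `y = zAy` off `v`, so
the maximum principle annihilates it. -/
theorem StronglyConnected.pAt_ne_zero (hG : G.StronglyConnected) (v : V) {z : ℝ} (hz0 : 0 < z)
    (hz : z ≤ G.rho) : G.pAt v z ≠ 0 := by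
  intro h0
  obtain ⟨x, hx0, hx⟩ := Matrix.exists_mulVec_eq_zero_iff.2 h0
  obtain ⟨w, hw, hAw⟩ := hG.exists_rho_vector
  set y : V → ℝ := fun u => if h : u = v then 0 else x ⟨u, h⟩ with hy
  have hyx : ∀ u : {u // u ≠ v}, y u = x u := fun u => by simp [hy, u.2]
  have hyv : y v = 0 := by simp [hy]
  have hAy : ∀ u, u ≠ v → y u = z * (G.adjacency.mulVec y) u := by
    intro u hu
    have h1 : (G.adjacency.mulVec y) u = ∑ j : {j // j ≠ v}, G.adjacency u j * x j := by
      rw [Matrix.mulVec, dotProduct, ← Fintype.sum_subtype_add_sum_subtype (fun j => j ≠ v)]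
      rw [Finset.sum_congr rfl fun j _ => by rw [hyx], add_eq_left]
      refine Finset.sum_eq_zero fun j _ => ?_
      rw [not_not.1 j.2, hyv, mul_zero]
    have h2 := congrFun hx ⟨u, hu⟩
    have h3 : ∀ j : {j // j ≠ v}, (1 - z • G.adjacency) u j * x j =
        (if (⟨u, hu⟩ : {j // j ≠ v}) = j then x j else 0) - z * (G.adjacency u j * x j) := by
      intro j
      simp only [Matrix.sub_apply, Matrix.smul_apply, smul_eq_mul, Matrix.one_apply, sub_mul,
        ite_mul, one_mul, zero_mul, Subtype.ext_iff, mul_assoc]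
    simp only [Matrix.mulVec, dotProduct, Matrix.submatrix_apply, h3, Finset.sum_sub_distrib,
      Finset.sum_ite_eq, Finset.mem_univ, if_true, Pi.zero_apply, ← Finset.mul_sum] at h2
    rw [h1, hyx ⟨u, hu⟩]
    linarith
  have hy0 : y = 0 := by
    refine Matrix.eq_zero_of_le_mulVec G.adjacency_nonneg hG.reflTransGen_adjacency hz0 hw
      (fun i => ?_) hyv fun u hu => ?_
    · rw [← hAw i]
      refine mul_le_mul_of_nonneg_right hz (Finset.sum_nonneg fun j _ => ?_)
      exact mul_nonneg (G.adjacency_nonneg i j) (hw j).le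
    · rw [hAy u hu, abs_mul, abs_of_pos hz0]
      refine mul_le_mul_of_nonneg_left ((Finset.abs_sum_le_sum_abs _ _).trans (le_of_eq ?_)) hz0.le
      refine Finset.sum_congr rfl fun j _ => ?_
      rw [abs_mul, abs_of_nonneg (G.adjacency_nonneg u j)]
  exact hx0 (funext fun u => by rw [← hyx, hy0]; rfl)

theorem StronglyConnected.qAt_eq (hG : G.StronglyConnected) (v : V) {z : ℝ} (hz0 : 0 < z)
    (hz : z ≤ G.rho) : G.qAt v z = 1 - G.returnSum v z := by
  rw [qAt, hG.p_eq v hz0.le hz, mul_div_cancel_right₀ _ (hG.pAt_ne_zero v hz0 hz)]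

theorem StronglyConnected.p_rho (hG : G.StronglyConnected) : G.p G.rho = 0 := by
  obtain ⟨w, hw, hAw⟩ := hG.exists_rho_vector
  refine Matrix.exists_mulVec_eq_zero_iff.1 ⟨w, fun h => ?_, ?_⟩
  · have := hw (G.s (Classical.arbitrary E))
    rw [h] at this
    exact lt_irrefl _ this
  · ext u
    rw [Matrix.sub_mulVec, Matrix.one_mulVec, Matrix.smul_mulVec, Pi.sub_apply, Pi.smul_apply,
      smul_eq_mul, hAw u, sub_self, Pi.zero_apply]

theorem StronglyConnected.returnSum_rho (hG : G.StronglyConnected) (v : V) :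
    G.returnSum v G.rho = 1 := by
  have h := hG.p_eq v hG.rho_pos.le le_rfl
  rw [hG.p_rho, zero_eq_mul] at h
  linarith [h.resolve_right (hG.pAt_ne_zero v hG.rho_pos le_rfl)]

/-- The quotient rule, with one term killed by `p(ρ) = 0`. Working with `1 - q_v` instead of `F`
supplies a two-sided derivative at the endpoint `ρ`. -/
theorem StronglyConnected.hasDerivAt_one_sub_qAt (hG : G.StronglyConnected) (v : V) :
    HasDerivAt (fun z => 1 - G.qAt v z) (-(deriv G.p G.rho / G.pAt v G.rho)) G.rho := by
  have h0 := hG.pAt_ne_zero v hG.rho_pos le_rfl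
  have h := ((G.differentiable_p G.rho).hasDerivAt.div
    (G.differentiable_pAt v G.rho).hasDerivAt h0).const_sub 1
  rw [hG.p_rho, zero_mul, sub_zero, pow_two, mul_div_mul_right _ _ h0] at h
  exact h

theorem StronglyConnected.convexOn_one_sub_qAt (hG : G.StronglyConnected) (v : V) :
    ConvexOn ℝ (Set.Ioc 0 G.rho) (fun z => 1 - G.qAt v z) :=
  ((hG.convexOn_returnSum v).subset Set.Ioc_subset_Icc_self (convex_Ioc _ _)).congr
    fun z hz => by simp [hG.qAt_eq v hz.1 hz.2]

/-- Secants of the first-return generating function are no steeper than its tangent at `ρ`. -/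
theorem StronglyConnected.returnSum_sub_le (hG : G.StronglyConnected) (v : V) {t s : ℝ}
    (ht : 0 < t) (hts : t ≤ s) (hs : s ≤ G.rho) :
    G.returnSum v s - G.returnSum v t ≤ -(deriv G.p G.rho / G.pAt v G.rho) * (s - t) := by
  rcases hts.eq_or_lt with rfl | hts
  · simp
  have hc := hG.convexOn_one_sub_qAt v
  have htm : t ∈ Set.Ioc 0 G.rho := ⟨ht, hts.le.trans hs⟩
  have hsm : s ∈ Set.Ioc 0 G.rho := ⟨ht.trans hts, hs⟩
  have hrm : G.rho ∈ Set.Ioc 0 G.rho := ⟨hG.rho_pos, le_rfl⟩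
  have h1 := hc.slope_le_of_hasDerivAt htm hrm (hts.trans_le hs) (hG.hasDerivAt_one_sub_qAt v)
  have h2 := hc.secant_mono htm hsm hrm hts.ne' (hts.trans_le hs).ne' hs
  rw [slope_def_field] at h1
  have h3 := h2.trans h1
  rw [div_le_iff₀ (by linarith), hG.qAt_eq v hsm.1 hs, hG.qAt_eq v ht htm.2] at h3
  linarith

/-- From `F(0) = 0`, `F(ρ) = 1` and convexity, `F(ρ/2) ≤ 1/2`; so the secant over `[ρ/2, ρ]`, no
steeper than the tangent, already rises. -/
theorem StronglyConnected.neg_deriv_div_pos (hG : G.StronglyConnected) (v : V) :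
    0 < -(deriv G.p G.rho / G.pAt v G.rho) := by
  have hρ := hG.rho_pos
  have h := hG.returnSum_sub_le v (half_pos hρ) (half_le_self hρ.le) le_rfl
  have h1 := (And.right (hG.convexOn_returnSum v)) (Set.left_mem_Icc.2 hρ.le) (Set.right_mem_Icc.2 hρ.le)
    (a := 1 / 2) (b := 1 / 2) (by norm_num) (by norm_num) (by norm_num)
  have h2 : ((1 / 2 : ℝ) • (0 : ℝ) + (1 / 2 : ℝ) • G.rho) = G.rho / 2 := by simp; ring
  rw [h2, returnSum_zero, hG.returnSum_rho] at h1
  rw [hG.returnSum_rho] at h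
  simp only [smul_eq_mul] at h1
  have h3 : 0 < -(deriv G.p G.rho / G.pAt v G.rho) * (G.rho - G.rho / 2) := by linarith
  exact pos_of_mul_pos_left h3 (by linarith)

end Adjacency

end DiMultigraph

namespace DiMultigraph

open scoped ENNReal

variable {V E : Type*}

/-! ### Balanced words over the first-return loops -/

theorem FirstPassage.ne_nil {G : DiMultigraph V E} {v u : V} {c : List E}
    (h : G.FirstPassage v u c) : c ≠ [] := by
  rintro rfl
  exact h

/-- The first-passage paths form a prefix code. -/
theorem FirstPassage.append_inj {G : DiMultigraph V E} {v u : V} {a b : List E}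
    (ha : G.FirstPassage v u a) (hb : G.FirstPassage v u b) {x y : List (E ⊕ E)}
    (h : a.map Sum.inl ++ x = b.map Sum.inl ++ y) : a = b ∧ x = y := by
  induction a generalizing b u with
  | nil => exact ha.elim
  | cons e a ih =>
    cases b with
    | nil => exact hb.elim
    | cons f b =>
      simp only [List.map_cons, List.cons_append, List.cons.injEq, Sum.inl.injEq] at h
      obtain ⟨rfl, h⟩ := h
      rcases ha.2 with ⟨hr, rfl⟩ | ⟨hr, ha'⟩ <;> rcases hb.2 with ⟨hr', rfl⟩ | ⟨hr', hb'⟩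
      · exact ⟨rfl, by simpa using h⟩
      · exact (hr' hr).elim
      · exact (hr hr').elim
      · obtain ⟨rfl, hxy⟩ := ih ha' hb' h
        exact ⟨rfl, hxy⟩

/-- The first-return loops at `v`. -/
abbrev ReturnLoop (G : DiMultigraph V E) (v : V) : Type _ := {c : List E // G.FirstPassage v v c}

/-- The balanced word with a given nesting structure of first-return loops. -/
def dyckWord (G : DiMultigraph V E) (v : V) : BinaryTree (G.ReturnLoop v) → List (E ⊕ E)
  | .nil => []
  | .node c l r => c.1.map Sum.inl ++
      (dyckWord G v l ++ (c.1.reverse.map Sum.inr ++ dyckWord G v r))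

theorem head?_map_inr_append_ne (G : DiMultigraph V E) {v : V} (c : G.ReturnLoop v)
    (x : List (E ⊕ E)) (e : E) : (c.1.reverse.map Sum.inr ++ x).head? ≠ some (Sum.inl e) := by
  cases h : c.1.reverse with
  | nil => exact (c.2.ne_nil (List.reverse_eq_nil_iff.1 h)).elim
  | cons => simp

theorem head?_dyckWord_node (G : DiMultigraph V E) {v : V} (c : G.ReturnLoop v)
    (l r : BinaryTree (G.ReturnLoop v)) (x : List (E ⊕ E)) :
    ∃ e, (G.dyckWord v (.node c l r) ++ x).head? = some (Sum.inl e) := by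
  obtain ⟨c, hc⟩ := c
  cases c with
  | nil => exact hc.elim
  | cons e c => exact ⟨e, by simp [dyckWord]⟩

/-- Unique decoding: the opening loop is read off by the prefix code, and the inner word ends before
a letter `e⁺`, whereas a nonempty balanced word begins with some `e⁻`. The tails `x`, `x'` carry
this through the induction. -/
theorem dyckWord_append_inj (G : DiMultigraph V E) {v : V} {t t' : BinaryTree (G.ReturnLoop v)}
    {x x' : List (E ⊕ E)} (hx : ∀ e, x.head? ≠ some (Sum.inl e))
    (hx' : ∀ e, x'.head? ≠ some (Sum.inl e)) (h : G.dyckWord v t ++ x = G.dyckWord v t' ++ x') :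
    t = t' ∧ x = x' := by
  induction t generalizing t' x x' with
  | nil =>
    cases t' with
    | nil => exact ⟨rfl, h⟩
    | node c l r =>
      obtain ⟨e, he⟩ := G.head?_dyckWord_node c l r x'
      exact (hx e (by rw [← he, ← h]; rfl)).elim
  | node c l r ihl ihr =>
    cases t' with
    | nil =>
      obtain ⟨e, he⟩ := G.head?_dyckWord_node c l r x
      exact (hx' e (by rw [← he, h]; rfl)).elim
    | node c' l' r' =>
      simp only [dyckWord, List.append_assoc] at h
      obtain ⟨hc, h₁⟩ := c.2.append_inj c'.2 h
      obtain rfl : c = c' := Subtype.ext hc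
      obtain ⟨rfl, h₂⟩ := ihl (G.head?_map_inr_append_ne c _) (G.head?_map_inr_append_ne c _) h₁
      obtain ⟨rfl, h₃⟩ := ihr hx hx' (List.append_cancel_left h₂)
      exact ⟨rfl, h₃⟩

theorem dyckWord_injective (G : DiMultigraph V E) (v : V) :
    Function.Injective (G.dyckWord v) := fun t t' h =>
  (G.dyckWord_append_inj (x := []) (x' := []) (by simp) (by simp) (by simpa using h)).1

theorem length_dyckWord_node (G : DiMultigraph V E) {v : V} (c : G.ReturnLoop v)
    (l r : BinaryTree (G.ReturnLoop v)) : (G.dyckWord v (.node c l r)).length =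
      2 * c.1.length + (G.dyckWord v l).length + (G.dyckWord v r).length := by
  simp only [dyckWord, List.length_append, List.length_map, List.length_reverse]
  ring

theorem tsum_tree_eq {α : Type*} (f : BinaryTree α → ℝ≥0∞) :
    ∑' t, f t = f .nil + ∑' a, ∑' l, ∑' r, f (.node a l r) := by
  classical
  rw [ENNReal.tsum_eq_add_tsum_ite .nil]
  have h : ∀ a, ∑' l, ∑' r, f (.node a l r) = ∑' q : BinaryTree α × BinaryTree α, f (.node a q.1 q.2) :=
    fun a => (ENNReal.tsum_prod (f := fun l r => f (.node a l r))).symm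
  simp only [h]
  rw [← ENNReal.tsum_prod (f := fun a (q : BinaryTree α × BinaryTree α) => f (.node a q.1 q.2))]
  congr 1
  have hinj : Function.Injective fun q : α × BinaryTree α × BinaryTree α => BinaryTree.node q.1 q.2.1 q.2.2 := by
    rintro ⟨a, l, r⟩ ⟨b, l', r'⟩ h
    simpa using h
  rw [← hinj.tsum_eq]
  · simp
  · rintro (_ | ⟨a, l, r⟩) h
    · simp at h
    · exact ⟨(a, l, r), rfl⟩

theorem passageSum_top_self (G : DiMultigraph V E) (v : V) (z : ℝ≥0∞) :
    G.passageSum v z ⊤ v = ∑' c : G.ReturnLoop v, z ^ c.1.length := by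
  classical
  refine Eq.trans ?_ (tsum_subtype {c | G.FirstPassage v v c} fun c => z ^ c.length).symm
  refine tsum_congr fun c => ?_
  by_cases h : G.FirstPassage v v c
  · rw [if_pos ⟨h, le_top⟩, Set.indicator_of_mem (by exact h)]
  · rw [if_neg fun h' => h h'.1, Set.indicator_of_notMem (by exact h)]

/-- The functional equation of the generating function of the balanced words. -/
theorem tsum_dyckWord_eq (G : DiMultigraph V E) (v : V) (z : ℝ≥0∞) :
    ∑' t, z ^ (G.dyckWord v t).length = 1 + G.passageSum v (z ^ 2) ⊤ v *
      (∑' t, z ^ (G.dyckWord v t).length) * ∑' t, z ^ (G.dyckWord v t).length := by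
  have h : ∑' c, ∑' l, ∑' r, z ^ (G.dyckWord v (.node c l r)).length =
      G.passageSum v (z ^ 2) ⊤ v * (∑' t, z ^ (G.dyckWord v t).length) *
        ∑' t, z ^ (G.dyckWord v t).length := by
    simp only [length_dyckWord_node, pow_add, pow_mul, ENNReal.tsum_mul_left,
      ENNReal.tsum_mul_right, passageSum_top_self]
  rw [← h, tsum_tree_eq]
  simp [dyckWord]

/-- If the generating function of the balanced words converges, then the first-return generating
function takes a value at most `1 / 4`. -/
theorem passageSum_sq_le (G : DiMultigraph V E) (v : V) (z : ℝ≥0∞)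
    (h : ∑' t, z ^ (G.dyckWord v t).length ≠ ⊤) :
    (G.passageSum v (z ^ 2) ⊤ v).toReal ≤ 1 / 4 := by
  have hD := congrArg ENNReal.toReal (G.tsum_dyckWord_eq v z)
  set D := ∑' t, z ^ (G.dyckWord v t).length
  have htop : G.passageSum v (z ^ 2) ⊤ v * D * D ≠ ⊤ := by
    intro h'
    rw [h', add_top] at hD
    have := G.tsum_dyckWord_eq v z
    rw [show (∑' t, z ^ (G.dyckWord v t).length) = D from rfl, h', add_top] at this
    exact h this
  rw [ENNReal.toReal_add ENNReal.one_ne_top htop, ENNReal.toReal_mul, ENNReal.toReal_mul,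
    ENNReal.toReal_one] at hD
  have h0 : (0 : ℝ) ≤ (G.passageSum v (z ^ 2) ⊤ v).toReal := ENNReal.toReal_nonneg
  have hD0 : (0 : ℝ) ≤ D.toReal := ENNReal.toReal_nonneg
  have hD1 : 1 ≤ D.toReal := by
    have := mul_nonneg (mul_nonneg h0 hD0) hD0
    linarith
  -- If the value exceeded `1/4`, then `D > 1 + D²/4`, against `(D/2 - 1)² ≥ 0`.
  by_contra hlt
  have := mul_pos (mul_pos (sub_pos.2 (not_le.1 hlt)) (zero_lt_one.trans_le hD1))
    (zero_lt_one.trans_le hD1)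
  linarith [sq_nonneg (D.toReal / 2 - 1)]

/-! ### The action of the graph inverse semigroup on stacks -/

open Classical in
/-- The partial action of the generators on the states, which consist of a current vertex and a
stack of edges: `e⁺` pushes `e` and `e⁻` pops it. -/
noncomputable def genAct (G : DiMultigraph V E) : Gen V E → V × List E → Option (V × List E)
  | .pos e, (u, l) => if u = G.s e then some (G.r e, e :: l) else none
  | .idem w, (u, l) => if u = w then some (u, l) else none
  | .neg _, (_, []) => none
  | .neg e, (u, f :: l) => if f = e ∧ u = G.r e then some (G.s e, l) else none

/-- The linear map that extends a partial map of a basis. -/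
noncomputable def partialEnd {S : Type*} (f : S → Option S) : Module.End ℤ (S →₀ ℤ) :=
  Finsupp.linearCombination ℤ fun s => (f s).elim 0 fun s' => Finsupp.single s' 1

theorem partialEnd_single {S : Type*} (f : S → Option S) (s : S) :
    partialEnd f (Finsupp.single s 1) = (f s).elim 0 fun s' => Finsupp.single s' 1 := by
  simp [partialEnd]

/-- The representation of the free monoid with zero by partial maps of states. -/
noncomputable def freeRep (G : DiMultigraph V E) :
    WithZero (FreeMonoid (Gen V E)) →*₀ Module.End ℤ (V × List E →₀ ℤ) :=
  WithZero.lift' (FreeMonoid.lift fun a => partialEnd (G.genAct a))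

theorem freeRep_gen (G : DiMultigraph V E) (a : Gen V E) :
    G.freeRep (gen a) = partialEnd (G.genAct a) := by
  rw [freeRep, gen, WithZero.lift'_coe, FreeMonoid.lift_eval_of]

/-- Checked on basis states. The rightmost factor acts first, so `e⁻e⁺` pushes and then pops `e`,
while `f⁻g⁺` tries to pop the wrong edge. -/
theorem freeRep_eq_of_rel (G : DiMultigraph V E) {x y : WithZero (FreeMonoid (Gen V E))}
    (h : G.Rel x y) : G.freeRep x = G.freeRep y := by
  have hmul : ∀ (f g : V × List E → Option (V × List E)) s,
      (partialEnd f * partialEnd g) (Finsupp.single s 1) =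
        ((g s).bind f).elim 0 fun s' => Finsupp.single s' 1 := by
    intro f g s
    rw [Module.End.mul_apply, partialEnd_single]
    cases g s with
    | none => simp
    | some s' => simp [partialEnd_single]
  refine Finsupp.lhom_ext' fun s => LinearMap.ext_ring ?_
  simp only [LinearMap.comp_apply, Finsupp.lsingle_apply]
  obtain ⟨u, l⟩ := s
  cases h <;>
    simp only [map_mul, freeRep_gen, hmul, partialEnd_single, map_zero, LinearMap.zero_apply]
  case idem_sq w => by_cases h : u = w <;> simp [genAct, h]
  case idem_mul w w' hne =>
    by_cases h : u = w'
    · simp [genAct, h, hne.symm]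
    · simp [genAct, h]
  case idem_neg e =>
    cases l with
    | nil => simp [genAct]
    | cons f l => by_cases h : f = e ∧ u = G.r e <;> simp [genAct, h]
  case neg_idem e =>
    cases l with
    | nil => by_cases h : u = G.r e <;> simp [genAct, h]
    | cons f l => by_cases h : f = e <;> by_cases h' : u = G.r e <;> simp [genAct, h, h']
  case idem_pos e => by_cases h : u = G.s e <;> simp [genAct, h]
  case pos_idem e => by_cases h : u = G.s e <;> simp [genAct, h]
  case neg_pos_self e => by_cases h : u = G.s e <;> simp [genAct, h]
  case neg_pos f g hne => by_cases h : u = G.s g <;> simp [genAct, h, hne.symm]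

/-- The representation of the graph inverse semigroup by partial maps of states. -/
noncomputable def invRep (G : DiMultigraph V E) :
    G.InvSemigroup →* Module.End ℤ (V × List E →₀ ℤ) :=
  Con.lift G.invCon (G.freeRep : WithZero (FreeMonoid (Gen V E)) →* _)
    (Con.conGen_le.2 fun _ _ h => (Con.ker_rel _).2 (G.freeRep_eq_of_rel h))

/-- Hence a word that acts by a nonzero operator has a nonzero product. -/
theorem invRep_zero (G : DiMultigraph V E) : G.invRep 0 = 0 :=
  (Con.lift_coe (c := G.invCon) _ 0).trans (map_zero G.freeRep)

/-- The partial action of the letters on the states. -/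
noncomputable def letterAct (G : DiMultigraph V E) :
    E ⊕ E → V × List E → Option (V × List E)
  | .inl e => G.genAct (.neg e)
  | .inr e => G.genAct (.pos e)

theorem invRep_letter (G : DiMultigraph V E) (a : E ⊕ E) :
    G.invRep (G.letter a) = partialEnd (G.letterAct a) := by
  cases a with
  | inl e => exact (Con.lift_coe (c := G.invCon) _ _).trans (G.freeRep_gen _)
  | inr e => exact (Con.lift_coe (c := G.invCon) _ _).trans (G.freeRep_gen _)

/-- The states run against the reading order, since the last letter acts first. -/
theorem invRep_wordProd (G : DiMultigraph V E) {n : ℕ} (w : Fin n → E ⊕ E)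
    (σ : ℕ → V × List E) (h : ∀ k : Fin n, G.letterAct (w k) (σ (k + 1)) = some (σ k)) :
    G.invRep (G.wordProd w) (Finsupp.single (σ n) 1) = Finsupp.single (σ 0) 1 := by
  induction n generalizing σ with
  | zero => simp [wordProd]
  | succ n ih =>
    have h1 := ih (fun k => w k.succ) (fun k => σ (k + 1)) fun k => h k.succ
    have h2 : G.wordProd w = G.letter (w 0) * G.wordProd fun k : Fin n => w k.succ := by
      simp only [wordProd, List.ofFn_succ, List.prod_cons]
    have h0 := h 0
    simp only [Fin.val_zero, zero_add] at h0
    rw [h2, map_mul, Module.End.mul_apply, h1, invRep_letter, partialEnd_single, h0]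
    rfl

/-- A bi-infinite sequence that is realized by a bi-infinite run of stack states belongs to the
Markov-Dyck shift. -/
theorem mem_markovDyck_of_run (G : DiMultigraph V E) {x : ℤ → E ⊕ E} (σ : ℤ → V × List E)
    (h : ∀ i, G.letterAct (x i) (σ (i + 1)) = some (σ i)) : x ∈ G.markovDyck := by
  intro i n h0
  have h1 := G.invRep_wordProd (Subshift.block x i n) (fun k => σ (i + (k : ℕ))) fun k => by
    have := h (i + (k : ℕ))
    rw [add_assoc] at this
    exact_mod_cast this
  rw [h0, invRep_zero, LinearMap.zero_apply] at h1
  exact one_ne_zero (Finsupp.single_eq_zero.1 h1.symm)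

/-- The partial action of words on the states. -/
noncomputable def listAct (G : DiMultigraph V E) :
    List (E ⊕ E) → V × List E → Option (V × List E)
  | [], s => some s
  | a :: w, s => (listAct G w s).bind (G.letterAct a)

theorem listAct_append (G : DiMultigraph V E) (w w' : List (E ⊕ E)) (s : V × List E) :
    G.listAct (w ++ w') s = (G.listAct w' s).bind (G.listAct w) := by
  induction w with
  | nil => cases h : G.listAct w' s <;> simp [listAct, h]
  | cons a w ih => cases h : G.listAct w' s <;> simp [listAct, ih, h]

/-- Acting from the right, the reversed word pushes the edges of `c` in path order, leaving the last
one on top. -/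
theorem FirstPassage.listAct_push {G : DiMultigraph V E} {v u : V} {c : List E}
    (hc : G.FirstPassage v u c) (l : List E) :
    G.listAct (c.reverse.map Sum.inr) (u, l) = some (v, c.reverse ++ l) := by
  induction c generalizing u l with
  | nil => exact hc.elim
  | cons e c ih =>
    obtain ⟨rfl, h⟩ := hc
    rw [List.reverse_cons, List.map_append, listAct_append]
    have : G.listAct (List.map Sum.inr [e]) (G.s e, l) = some (G.r e, e :: l) := by
      simp [listAct, letterAct, genAct]
    rw [this, Option.bind_some]
    rcases h with ⟨hr, rfl⟩ | ⟨_, hc⟩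
    · simp [listAct, hr]
    · rw [ih hc]
      simp

theorem FirstPassage.listAct_pop {G : DiMultigraph V E} {v u : V} {c : List E}
    (hc : G.FirstPassage v u c) (l : List E) :
    G.listAct (c.map Sum.inl) (v, c.reverse ++ l) = some (u, l) := by
  induction c generalizing u l with
  | nil => exact hc.elim
  | cons e c ih =>
    obtain ⟨rfl, h⟩ := hc
    rw [List.map_cons, listAct]
    have : G.listAct (c.map Sum.inl) (v, (e :: c).reverse ++ l) = some (G.r e, e :: l) := by
      rcases h with ⟨hr, rfl⟩ | ⟨_, hc⟩
      · simp [listAct, hr]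
      · simpa using ih hc (e :: l)
    rw [this]
    simp [letterAct, genAct]

theorem listAct_dyckWord (G : DiMultigraph V E) (v : V) (t : BinaryTree (G.ReturnLoop v)) (l : List E) :
    G.listAct (G.dyckWord v t) (v, l) = some (v, l) := by
  induction t generalizing l with
  | nil => rfl
  | node c t t' ih ih' =>
    rw [dyckWord, listAct_append, listAct_append, listAct_append, ih', Option.bind_some,
      c.2.listAct_push, Option.bind_some, ih, Option.bind_some, c.2.listAct_pop]

/-! ### Turns of balanced words -/

/-- After the letter `a` the current vertex, in the reading of words as paths, is `v`. -/
def EndsAt (G : DiMultigraph V E) (v : V) : E ⊕ E → Prop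
  | .inl e => G.r e = v
  | .inr e => G.s e = v

/-- A change of direction between the letters `a` and `b` takes place at `v`. -/
def TurnsAt (G : DiMultigraph V E) (v : V) (a b : E ⊕ E) : Prop :=
  G.EndsAt v a ∨ a.isLeft = b.isLeft

/-- All turns of `w`, including a possible one after its last letter, are at `v`. -/
def TurnsOnlyAt (G : DiMultigraph V E) (v : V) (w : List (E ⊕ E)) : Prop :=
  w.IsChain (G.TurnsAt v) ∧ ∀ a ∈ w.getLast?, G.EndsAt v a

theorem TurnsOnlyAt.append {G : DiMultigraph V E} {v : V} {w w' : List (E ⊕ E)}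
    (h : G.TurnsOnlyAt v w) (h' : G.TurnsOnlyAt v w') : G.TurnsOnlyAt v (w ++ w') := by
  refine ⟨List.isChain_append.2 ⟨h.1, h'.1, fun a ha b _ => Or.inl (h.2 a ha)⟩, fun a ha => ?_⟩
  rw [List.getLast?_append] at ha
  cases hw : w'.getLast? with
  | none => exact h.2 a (by simpa [hw] using ha)
  | some b => exact h'.2 a (by simpa [hw] using ha)

theorem isChain_turnsAt_map (G : DiMultigraph V E) (v : V) (f : E → E ⊕ E)
    (hf : ∀ e e', (f e).isLeft = (f e').isLeft) (c : List E) :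
    (c.map f).IsChain (G.TurnsAt v) := by
  rw [List.isChain_map]
  exact (List.pairwise_of_forall fun e e' => Or.inr (hf e e')).isChain

theorem FirstPassage.turnsOnlyAt_inl {G : DiMultigraph V E} {v u : V} {c : List E}
    (hc : G.FirstPassage v u c) : G.TurnsOnlyAt v (c.map Sum.inl) := by
  refine ⟨G.isChain_turnsAt_map v _ (fun _ _ => rfl) c, ?_⟩
  induction c generalizing u with
  | nil => exact hc.elim
  | cons e c ih =>
    rcases hc.2 with ⟨hr, rfl⟩ | ⟨_, hc⟩
    · simpa [EndsAt] using hr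
    · have := hc.ne_nil
      obtain ⟨f, c, rfl⟩ := List.exists_cons_of_ne_nil this
      simpa using ih hc

theorem FirstPassage.turnsOnlyAt_inr {G : DiMultigraph V E} {v : V} {c : List E}
    (hc : G.FirstPassage v v c) : G.TurnsOnlyAt v (c.reverse.map Sum.inr) := by
  refine ⟨G.isChain_turnsAt_map v _ (fun _ _ => rfl) _, ?_⟩
  cases c with
  | nil => exact hc.elim
  | cons e c => simpa [EndsAt] using hc.1

theorem turnsOnlyAt_dyckWord (G : DiMultigraph V E) (v : V) (t : BinaryTree (G.ReturnLoop v)) :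
    G.TurnsOnlyAt v (G.dyckWord v t) := by
  induction t with
  | nil => exact ⟨List.isChain_nil, by simp [dyckWord]⟩
  | node c t t' ih ih' =>
    exact c.2.turnsOnlyAt_inl.append (ih.append (c.2.turnsOnlyAt_inr.append ih'))

/-! ### Periodic points -/

theorem toNat_add_one_emod {L : ℕ} (hL : 0 < L) (i : ℤ) :
    ((i % L).toNat < L) ∧ (((i % L).toNat + 1 < L ∧ ((i + 1) % L).toNat = (i % L).toNat + 1) ∨
      ((i % L).toNat + 1 = L ∧ ((i + 1) % L).toNat = 0)) := by
  have hL' : (0 : ℤ) < L := by exact_mod_cast hL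
  have h0 := Int.emod_nonneg i hL'.ne'
  have h1 := Int.emod_lt_of_pos i hL'
  have h2 : (i + 1) % L = (i % L + 1) % L := (Int.emod_add_emod i L 1).symm
  refine ⟨by omega, ?_⟩
  by_cases h : i % L + 1 = L
  · right
    rw [h2, h, Int.emod_self]
    omega
  · left
    rw [h2, Int.emod_eq_of_lt (a := i % L + 1) (by omega) (by omega)]
    omega

/-- The periodic sequence with period word `w`. -/
def periodicPoint {α : Type*} (w : List α) (hw : 0 < w.length) (i : ℤ) : α :=
  w[(i % w.length).toNat]'(toNat_add_one_emod hw i).1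

/-- A word that fixes a state yields a periodic run, whose states come from the action of its
suffixes. The turn at the seam is allowed because the last letter ends at `v`. -/
theorem TurnsOnlyAt.periodicPoint_mem {G : DiMultigraph V E} {v : V} {w : List (E ⊕ E)}
    (hw : G.TurnsOnlyAt v w) (hL : 0 < w.length) {s : V × List E} (hs : G.listAct w s = some s) :
    periodicPoint w hL ∈ G.markovDyckAt v := by
  set k : ℤ → ℕ := fun i => (i % w.length).toNat with hk
  have hkL := toNat_add_one_emod hL
  have hturn : ∀ i, G.TurnsAt v (periodicPoint w hL i) (periodicPoint w hL (i + 1)) := by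
    intro i
    rcases (hkL i).2 with ⟨h1, h2⟩ | ⟨h1, h2⟩
    · have := List.isChain_iff_getElem.1 hw.1 _ h1
      simpa only [periodicPoint, h2] using this
    · refine Or.inl (hw.2 _ ?_)
      rw [List.getLast?_eq_getElem?, Option.mem_def, List.getElem?_eq_some_iff]
      have h3 : w.length - 1 = (i % w.length).toNat := by omega
      exact ⟨by omega, by simp only [periodicPoint, h3]⟩
  have hsome : ∀ n, ∃ s', G.listAct (w.drop n) s = some s' := by
    intro n
    have h := G.listAct_append (w.take n) (w.drop n) s
    rw [List.take_append_drop, hs] at h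
    cases h' : G.listAct (w.drop n) s with
    | none => simp [h'] at h
    | some s' => exact ⟨s', rfl⟩
  choose σ hσ using hsome
  refine ⟨G.mem_markovDyck_of_run (fun i => σ (k i)) fun i => ?_, ?_, ?_⟩
  · have h1 := hσ (k i)
    rw [List.drop_eq_getElem_cons (hkL i).1, listAct, hσ, Option.bind_some] at h1
    rcases (hkL i).2 with ⟨_, h2⟩ | ⟨h3, h2⟩
    · have : k (i + 1) = k i + 1 := h2
      rw [this]
      exact h1
    · have h4 : σ (k i + 1) = s := by
        have := hσ (k i + 1)
        rw [show k i + 1 = w.length from h3, List.drop_length] at this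
        exact (Option.some_inj.1 (h3 ▸ this)).symm
      have h5 : σ (k (i + 1)) = s := by
        have := hσ 0
        rw [List.drop_zero, hs] at this
        rw [show k (i + 1) = 0 from h2]
        exact (Option.some_inj.1 this).symm
      rw [h5, ← h4]
      exact h1
  · rintro i e he ⟨h1, h2⟩
    have := hturn i
    rw [h1, h2] at this
    simp [TurnsAt, EndsAt, he] at this
  · rintro i f g hf ⟨h1, h2⟩
    have := hturn i
    rw [h1, h2] at this
    simp [TurnsAt, EndsAt, hf] at this

/-- Enclosing the word in one further loop `c` makes the period nonempty even if the word is empty;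
the word sits at offset `c.1.length`. -/
theorem dyckWord_mem_language (G : DiMultigraph V E) {v : V} (c : G.ReturnLoop v)
    (t : BinaryTree (G.ReturnLoop v)) :
    (G.dyckWord v t).get ∈ Subshift.language (G.markovDyckAt v) (G.dyckWord v t).length := by
  set w := G.dyckWord v (.node c t .nil) with hw
  have hlen : w.length = 2 * c.1.length + (G.dyckWord v t).length := by
    rw [hw, length_dyckWord_node]
    rfl
  have hc : 0 < c.1.length := List.length_pos_iff.2 c.2.ne_nil
  have hL : 0 < w.length := by omega
  refine ⟨periodicPoint w hL, (G.turnsOnlyAt_dyckWord v _).periodicPoint_mem hL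
    (G.listAct_dyckWord v _ []), c.1.length, ?_⟩
  ext1 k
  have hk := k.2
  have h1 : (((c.1.length : ℤ) + (k : ℕ)) % w.length).toNat = c.1.length + k := by
    rw [Int.emod_eq_of_lt (by omega) (by omega)]
    omega
  simp only [Subshift.block, periodicPoint, h1, List.get_eq_getElem]
  simp only [hw, dyckWord]
  rw [List.getElem_append_right (by simp), List.getElem_append_left (by simp)]
  simp

end DiMultigraph

/-! ### Entropy and the generating function of the language. -/

namespace Subshift

variable {α : Type*} [Finite α]

theorem ncard_language_add_le (X : Set (ℤ → α)) (m n : ℕ) :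
    (language X (m + n)).ncard ≤ (language X m).ncard * (language X n).ncard := by
  rw [← Set.ncard_prod]
  refine Set.ncard_le_ncard_of_injOn
    (fun w => (fun k => w (Fin.castAdd n k), fun k => w (Fin.natAdd m k))) ?_ ?_ (Set.toFinite _)
  · rintro _ ⟨x, hx, i, rfl⟩
    refine ⟨⟨x, hx, i, rfl⟩, x, hx, i + m, ?_⟩
    ext1 k
    simp [block, add_assoc]
  · intro w _ w' _ h
    rw [Prod.mk.injEq] at h
    ext1 k
    refine Fin.addCases (fun j => congrFun h.1 j) (fun j => congrFun h.2 j) k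

theorem subadditive_log_ncard_language (X : Set (ℤ → α)) :
    Subadditive fun n => Real.log ((language X n).ncard : ℝ) := by
  intro m n
  have h := ncard_language_add_le X m n
  -- For an empty language the convention `log 0 = 0` makes the inequality trivial.
  rcases Nat.eq_zero_or_pos (language X (m + n)).ncard with h0 | hpos
  · simp only [h0, Nat.cast_zero, Real.log_zero]
    exact add_nonneg (Real.log_natCast_nonneg _) (Real.log_natCast_nonneg _)
  · have hmn := hpos.trans_le h
    have hm := pos_of_mul_pos_left hmn (Nat.zero_le _)
    have hn := pos_of_mul_pos_right hmn (Nat.zero_le _)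
    rw [← Real.log_mul (by positivity) (by positivity)]
    exact Real.log_le_log (by exact_mod_cast hpos) (by exact_mod_cast h)

/-- The limit that defines the topological entropy exists. -/
theorem tendsto_entropySeq (X : Set (ℤ → α)) :
    Tendsto (entropySeq X) atTop (𝓝 (entropy X)) := by
  have h := (subadditive_log_ncard_language X).tendsto_lim
    ⟨0, by rintro _ ⟨n, rfl⟩; exact div_nonneg (Real.log_natCast_nonneg _) n.cast_nonneg⟩
  have h' : Tendsto (entropySeq X) atTop (𝓝 _) := h
  rwa [entropy, h'.limUnder_eq]

/-- The generating function of the language converges inside the disc of radius `exp (-h(X))`. -/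
theorem tsum_ncard_language_ne_top (X : Set (ℤ → α)) {z : ℝ} (hz : 0 < z)
    (h : entropy X < -Real.log z) :
    ∑' n, ((language X n).ncard : ENNReal) * ENNReal.ofReal z ^ n ≠ ⊤ := by
  -- Eventually there are at most `e^{bn}` words, and `e^b z < 1`: compare with a geometric series.
  obtain ⟨b, hb, hbz⟩ := exists_between h
  have hsum : Summable fun n => ((language X n).ncard : ℝ) * z ^ n := by
    have hr : Real.exp b * z < 1 := by
      rw [← Real.exp_log hz, ← Real.exp_add, Real.exp_lt_one_iff]
      linarith
    refine Summable.of_norm_bounded_eventually_nat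
      (summable_geometric_of_lt_one (by positivity) hr) ?_
    filter_upwards [(tendsto_entropySeq X).eventually_lt_const hb, eventually_gt_atTop 0]
      with n hn hn0
    have hn0' : (0 : ℝ) < n := by exact_mod_cast hn0
    rw [Real.norm_of_nonneg (by positivity), mul_pow, ← Real.exp_nat_mul]
    refine mul_le_mul_of_nonneg_right ?_ (by positivity)
    rcases Nat.eq_zero_or_pos (language X n).ncard with h0 | hpos
    · rw [h0, Nat.cast_zero]
      positivity
    · rw [entropySeq, div_lt_iff₀ hn0', mul_comm] at hn
      exact (Real.log_le_iff_le_exp (by exact_mod_cast hpos)).1 hn.le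
  have := hsum.tsum_ofReal_ne_top
  refine ne_of_eq_of_ne (tsum_congr fun n => ?_) this
  rw [ENNReal.ofReal_mul (Nat.cast_nonneg _), ENNReal.ofReal_natCast, ENNReal.ofReal_pow hz.le]

end Subshift

/-! ### The entropy bound. -/

namespace DiMultigraph

variable {V E : Type*} [Finite E]

theorem tsum_dyckWord_le (G : DiMultigraph V E) {v : V} (c : G.ReturnLoop v) (z : ENNReal) :
    ∑' t, z ^ (G.dyckWord v t).length ≤
      ∑' n, ((Subshift.language (G.markovDyckAt v) n).ncard : ENNReal) * z ^ n := by
  have hinj : Function.Injective fun t : BinaryTree (G.ReturnLoop v) =>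
      (⟨(G.dyckWord v t).length, (G.dyckWord v t).get, G.dyckWord_mem_language c t⟩ :
        Σ n, Subshift.language (G.markovDyckAt v) n) := by
    intro t t' h
    refine G.dyckWord_injective v ?_
    have := congrArg (fun q : Σ n, Subshift.language (G.markovDyckAt v) n =>
      List.ofFn q.2.1) h
    simpa only [List.ofFn_get] using this
  refine (ENNReal.tsum_comp_le_tsum_of_injective hinj fun q => z ^ q.1).trans (le_of_eq ?_)
  rw [ENNReal.tsum_sigma']
  refine tsum_congr fun n => ?_
  refine ENNReal.tsum_const (z ^ n) |>.trans ?_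
  rw [← Set.encard, ← (Set.toFinite _).cast_ncard_eq]
  rfl

variable [Fintype V] [DecidableEq V] [Nonempty E] {G : DiMultigraph V E}

/-- An empty sum could not give `F(ρ) = 1`. -/
theorem StronglyConnected.nonempty_returnLoop (hG : G.StronglyConnected) (v : V) :
    Nonempty (G.ReturnLoop v) := by
  by_contra h
  rw [not_nonempty_iff] at h
  have := hG.returnSum_rho v
  rw [returnSum, passageSum_top_self, tsum_empty] at this
  simp at this

theorem StronglyConnected.returnSum_sq_le (hG : G.StronglyConnected) (v : V) {z : ℝ} (hz : 0 < z)
    (h : Subshift.entropy (G.markovDyckAt v) < -Real.log z) : G.returnSum v (z ^ 2) ≤ 1 / 4 := by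
  obtain ⟨c⟩ := hG.nonempty_returnLoop v
  rw [returnSum, ENNReal.ofReal_pow hz.le]
  exact G.passageSum_sq_le v _ ((G.tsum_dyckWord_le c _).trans_lt
    (Subshift.tsum_ncard_language_ne_top _ hz h).lt_top).ne

/-- The entropy of `X_v` exceeds `-log ρ + δ` whenever `δ` is at most the first-order estimate of
the distance to the singularity of the generating function of the balanced words. -/
theorem StronglyConnected.lt_entropy (hG : G.StronglyConnected) (v : V) {δ : ℝ} (hδ : 0 < δ)
    (h : 2 * G.rho ^ 2 * -(deriv G.p G.rho / G.pAt v G.rho) * δ ≤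
      G.returnSum v (G.rho ^ 2) - 1 / 4) :
    -Real.log G.rho + δ < Subshift.entropy (G.markovDyckAt v) := by
  by_contra! hle
  have hρ := hG.rho_pos
  have hρ1 := hG.rho_le_one
  set d := -(deriv G.p G.rho / G.pAt v G.rho)
  have hd : 0 < d := hG.neg_deriv_div_pos v
  have hρ2 : G.rho ^ 2 ≤ G.rho := by nlinarith
  -- Chosen so that the negated claim reads `h(X_v) ≤ -log y`. The inequality is strict only for `z
  -- < y`, hence the passage to the limit below.
  set y := G.rho * Real.exp (-δ) with hy
  have hy0 : 0 < y := by positivity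
  have hyρ : y < G.rho := mul_lt_of_lt_one_right hρ (Real.exp_lt_one_iff.2 (by linarith))
  have hlogy : Real.log y = Real.log G.rho - δ := by
    rw [hy, Real.log_mul hρ.ne' (Real.exp_pos _).ne', Real.log_exp]; ring
  have hbound : ∀ z ∈ Set.Ioo 0 y, G.returnSum v (G.rho ^ 2) - 1 / 4 ≤ d * (G.rho ^ 2 - z ^ 2) := by
    rintro z ⟨hz0, hzy⟩
    have h1 := hG.returnSum_sq_le v hz0 (by
      have := Real.log_lt_log hz0 hzy
      linarith)
    have h2 := hG.returnSum_sub_le v (pow_pos hz0 2)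
      (pow_le_pow_left₀ hz0.le (hzy.trans hyρ).le 2) hρ2
    linarith
  have hlim : G.returnSum v (G.rho ^ 2) - 1 / 4 ≤ d * (G.rho ^ 2 - y ^ 2) := by
    have hc : Tendsto (fun z => d * (G.rho ^ 2 - z ^ 2)) (𝓝[<] y) (𝓝 (d * (G.rho ^ 2 - y ^ 2))) :=
      (Continuous.tendsto (by fun_prop) y).mono_left nhdsWithin_le_nhds
    refine ge_of_tendsto hc ?_
    filter_upwards [Ioo_mem_nhdsLT hy0] with z hz using hbound z hz
  -- The source of strictness in the theorem.
  have hexp : 1 - 2 * δ < Real.exp (-δ) ^ 2 := by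
    rw [← Real.exp_nat_mul]
    have := Real.add_one_lt_exp (x := ((2 : ℕ) : ℝ) * -δ) (by push_cast; linarith)
    push_cast at this ⊢
    linarith
  have hy2 : y ^ 2 = G.rho ^ 2 * Real.exp (-δ) ^ 2 := by rw [hy, mul_pow]
  rw [hy2] at hlim
  have h3 := mul_lt_mul_of_pos_left hexp (mul_pos hd (pow_pos hρ 2))
  linarith

end DiMultigraph

theorem theorem3p5 {V E : Type*} [Fintype V] [DecidableEq V] [Finite E] [Nonempty E]
    (G : DiMultigraph V E) (hG : G.StronglyConnected) (v : V)
    (hq : G.qAt v (G.rho ^ 2) < 3 / 4) :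
    Filter.Tendsto (Subshift.entropySeq (G.markovDyckAt v)) Filter.atTop
        (nhds (Subshift.entropy (G.markovDyckAt v))) ∧
      Subshift.entropy (G.markovDyckAt v) >
        -Real.log G.rho +
          G.pAt v G.rho / (2 * G.rho ^ 2 * deriv G.p G.rho) *
            (G.qAt v (G.rho ^ 2) - 3 / 4) := by
  refine ⟨Subshift.tendsto_entropySeq _, ?_⟩
  have hρ := hG.rho_pos
  have hρ2 : G.rho ^ 2 ≤ G.rho := by nlinarith [hG.rho_le_one]
  have hd := hG.neg_deriv_div_pos v
  have hp := hG.pAt_ne_zero v hρ le_rfl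
  have hp' : deriv G.p G.rho ≠ 0 := by
    intro h0
    rw [h0] at hd
    simp at hd
  rw [hG.qAt_eq v (pow_pos hρ 2) hρ2] at hq ⊢
  -- The correction term is exactly the `δ` for which the hypothesis of `lt_entropy` holds with
  -- equality.
  have hδ : G.pAt v G.rho / (2 * G.rho ^ 2 * deriv G.p G.rho) *
      (1 - G.returnSum v (G.rho ^ 2) - 3 / 4) = (G.returnSum v (G.rho ^ 2) - 1 / 4) /
        (2 * G.rho ^ 2 * -(deriv G.p G.rho / G.pAt v G.rho)) := by
    field_simp
    ring
  rw [hδ]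
  have hpos : 0 < 2 * G.rho ^ 2 * -(deriv G.p G.rho / G.pAt v G.rho) := by positivity
  exact hG.lt_entropy v (div_pos (by linarith) hpos) (mul_div_cancel₀ _ hpos.ne').le
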